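/- \textbf{Model.} There are $n$ nodes with distinct IDs from a set $U\subseteq\mathbb Z$. Every two distinct nodes are joined by one bidirectional link, and each node $u$ addresses its $n-1$ links by ports $1,\dots,n-1$. A \emph{port mapping} $p$ assigns the ports to the links: $p(u,i)=(v,j)$ means that a message sent by $u$ over port $i$ is received by $v\neq u$ over port $j$; then also $p(v,j)=(u,i)$, and distinct ports of a node lead to distinct nodes. A deterministic algorithm runs in synchronous rounds $1,2,\dots$, and all nodes start in round $1$, each knowing only $n$ and its own ID. In each round every node that has not terminated sends over each of its ports at most one message (of unrestricted size), as a function of its state, and then updates its state as a function of its old state and of the messages received over its ports in this round. A node that terminates outputs a bit, and from then on it sends no messages. The algorithm \emph{elects a leader in $T$ rounds} for the ID set $U$ if, for every assignment of distinct IDs from $U$ to the nodes and every port mapping, all nodes have terminated after round $T$ and exactly one of them outputs $1$. \textbf{Theorem.} There are absolute constants $c>0$ and $n_0$ such that the following holds for every power of two $n\ge n_0$ and every integer $T=T(n)\ge 1$. Let $U$ be a set of integers (finite or infinite) with $$|U|\;\ge\; n^{\log_2 n}\,T^{\log_2 n-1},$$ and consider any deterministic algorithm that elects a leader in $T$ rounds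 for the ID set $U$ on the clique of $n$ nodes. Then there are an assignment of distinct IDs from $U$ to the nodes and a port mapping for which the nodes send, in total, at least $c\,n\log_2 n$ messages. That is, the algorithm must send $\Omega(n\log n)$ messages. -/

import Mathlib

universe u v

/-- A port mapping of the clique on the nodes `Fin n`, where each node has the `n - 1` ports
`Fin (n - 1)`: `p (u, i) = (v, j)` means that a message sent by `u` over its port `i` is received
by `v` over its port `j`. Links are bidirectional, no port leads back to its own node, and
distinct ports of a node lead to distinct nodes (so the `n - 1` ports of a node reach
each of the `n - 1` other nodes exactly once). -/
structure PortMapping (n : ℕ) where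
  toFun : Fin n × Fin (n - 1) → Fin n × Fin (n - 1)
  symm' : ∀ x, toFun (toFun x) = x
  ne_self : ∀ u i, (toFun (u, i)).1 ≠ u
  simple : ∀ u, Function.Injective fun i => (toFun (u, i)).1

/-- A deterministic algorithm for the synchronous clique of `n` nodes with simultaneous wake-up.
A node initially knows only its ID (and `n`); state spaces and message sizes are unrestricted,
and a node may send arbitrary, possibly distinct, messages over its ports in a round.
`output s = none` means that a node in state `s` has not terminated, and `output s = some b`
that it has terminated with the bit `b` (`true` = "I am the leader"). -/
structure CliqueAlgorithm (n : ℕ) where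
  State : Type u
  Msg : Type v
  /-- The initial state of a node, given its ID. -/
  init : ℤ → State
  /-- The message (if any) that a node sends over each port, given its state. -/
  send : State → Fin (n - 1) → Option Msg
  /-- The new state, given the old one and the messages received over the ports. -/
  step : State → (Fin (n - 1) → Option Msg) → State
  output : State → Option Bool

namespace CliqueAlgorithm

/-- The message that a node in state `s` actually sends over port `i`: a node that has
terminated sends nothing. -/
def sent {n : ℕ} (A : CliqueAlgorithm.{u, v} n) (s : A.State) (i : Fin (n - 1)) : Option A.Msg :=
  if (A.output s).isSome then none else A.send s i

/-- The state of every node after the first `r` rounds, in the execution with node IDs `ids` and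
port mapping `p`. In each round every node sends its messages, these are delivered along `p`, and
every node that has not terminated updates its state (a terminated node never changes again). -/
def stateAfter {n : ℕ} (A : CliqueAlgorithm.{u, v} n) (ids : Fin n → ℤ) (p : PortMapping n) :
    ℕ → Fin n → A.State
  | 0 => fun w => A.init (ids w)
  | r + 1 => fun w =>
      let s := stateAfter A ids p r
      if (A.output (s w)).isSome then s w
      else A.step (s w) fun j => A.sent (s (p.toFun (w, j)).1) (p.toFun (w, j)).2

/-- The number of messages sent in the first `R` rounds (by all nodes, over all ports). If all
nodes have terminated after `R` rounds, this is the number of messages of the entire execution. -/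
def messageCount {n : ℕ} (A : CliqueAlgorithm.{u, v} n) 
    (ids : Fin n → ℤ) (p : PortMapping n) (R : ℕ) : ℕ :=
  ∑ r ∈ Finset.range R, ∑ w : Fin n,
    (Finset.univ.filter fun i : Fin (n - 1) =>
      (A.sent (A.stateAfter ids p r w) i).isSome = true).card

/-- `A` solves (implicit) leader election within `T` rounds for the ID universe `U`: for every
assignment of distinct IDs from `U` to the nodes and every port mapping, all nodes have terminated
after `T` rounds and exactly one of them outputs that it is the leader. -/
def ElectsLeaderWithin {n : ℕ} (A : CliqueAlgorithm.{u, v} n) 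
    (U : Set ℤ) (T : ℕ) : Prop :=
  ∀ ids : Fin n → ℤ, Function.Injective ids → (∀ w, ids w ∈ U) → ∀ p : PortMapping n,
    (∀ w, (A.output (A.stateAfter ids p T w)).isSome = true) ∧
      ∃! w, A.output (A.stateAfter ids p T w) = some true

end CliqueAlgorithm

/-! The adversary wires ports lazily: a link is fixed only when a message is about to leave over a
free port, and its other end is then chosen inside the sender's cluster of IDs. This works until
some node is linked to every other node of the cluster (saturation, `exists_saturated`). Up to then
the cluster runs independently of the rest of the clique (`ValidFor.run_eq`).

Two clusters of size s that saturate in the same round are glued, and wiring continues in the union.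
The node that saturates the union had fewer than s links before and has gained at least s, so m
connected ports in each half become 2m + 2s in the union (`silent_or_busy_of_busy`). After i
doublings there are i * 2^i connected ports on 2^i IDs, and every link has carried a message; at
half the clique this is of order n log n.

Doubling needs clusters that are not silent, a silent cluster being one that gets through all T
rounds with no message leaving. At most n / 2^i disjoint clusters are silent (`card_silent_le`):
among one more, any n / 2^i would form a full execution with exactly one leader, so all would
contain equally many leaders, and a multiple of that number by n / 2^i ≥ 2 would be 1. Discarding
silent clusters, grouping by saturation round and pairing cost at most a factor n * T per doubling,
whence the bound on |U|. -/

/-! ### Partial port mappings and their extensions -/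

/-- A partial port mapping on the ID set `S`, written as an involution of the ports whose fixed
points are the ports that are not connected yet. -/
structure IsPartialMapping {n : ℕ} (f : ℤ × Fin (n - 1) → ℤ × Fin (n - 1)) (S : Finset ℤ) :
    Prop where
  invol : ∀ x, f (f x) = x
  ne_self : ∀ x, f x ≠ x → (f x).1 ≠ x.1
  simple : ∀ u i j, f (u, i) ≠ (u, i) → f (u, j) ≠ (u, j) → (f (u, i)).1 = (f (u, j)).1 → i = j
  supp : ∀ x, x.1 ∉ S → f x = x

/-- `g` contains all the links of `f`. -/
def ExtendsLinks {n : ℕ} (f g : ℤ × Fin (n - 1) → ℤ × Fin (n - 1)) : Prop :=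
  ∀ x, f x ≠ x → g x = f x

/-- The connected ports of the nodes in `S`. -/
def linkedPorts {n : ℕ} (f : ℤ × Fin (n - 1) → ℤ × Fin (n - 1)) (S : Finset ℤ) :
    Finset (ℤ × Fin (n - 1)) :=
  (S ×ˢ Finset.univ).filter fun x => f x ≠ x

/-- The free ports of the nodes in `S`. -/
def freePorts {n : ℕ} (f : ℤ × Fin (n - 1) → ℤ × Fin (n - 1)) (S : Finset ℤ) :
    Finset (ℤ × Fin (n - 1)) :=
  (S ×ˢ Finset.univ).filter fun x => f x = x

/-- The connected ports of the node `u`. -/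
def nodePorts {n : ℕ} (f : ℤ × Fin (n - 1) → ℤ × Fin (n - 1)) (u : ℤ) : Finset (Fin (n - 1)) :=
  Finset.univ.filter fun i => f (u, i) ≠ (u, i)

/-- The mapping `f` with an additional link between `x` and `y`. -/
def addLink {n : ℕ} (f : ℤ × Fin (n - 1) → ℤ × Fin (n - 1)) (x y : ℤ × Fin (n - 1)) :
    ℤ × Fin (n - 1) → ℤ × Fin (n - 1) :=
  fun z => if z = x then y else if z = y then x else f z

theorem ExtendsLinks.refl {n : ℕ} (f : ℤ × Fin (n - 1) → ℤ × Fin (n - 1)) : ExtendsLinks f f :=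
  fun _ _ => rfl

theorem ExtendsLinks.trans {n : ℕ} {f g h : ℤ × Fin (n - 1) → ℤ × Fin (n - 1)}
    (hfg : ExtendsLinks f g) (hgh : ExtendsLinks g h) : ExtendsLinks f h := by
  intro x hx
  rw [hgh x (by rwa [hfg x hx]), hfg x hx]

theorem mem_linkedPorts {n : ℕ} {f : ℤ × Fin (n - 1) → ℤ × Fin (n - 1)} {S : Finset ℤ}
    {x : ℤ × Fin (n - 1)} : x ∈ linkedPorts f S ↔ x.1 ∈ S ∧ f x ≠ x := by
  simp [linkedPorts]

theorem mem_freePorts {n : ℕ} {f : ℤ × Fin (n - 1) → ℤ × Fin (n - 1)} {S : Finset ℤ}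
    {x : ℤ × Fin (n - 1)} : x ∈ freePorts f S ↔ x.1 ∈ S ∧ f x = x := by
  simp [freePorts]

theorem isPartialMapping_id {n : ℕ} (S : Finset ℤ) :
    IsPartialMapping (n := n) (fun x => x) S :=
  ⟨fun _ => rfl, fun _ h => absurd rfl h, fun _ _ _ h => absurd rfl h, fun _ _ => rfl⟩

namespace IsPartialMapping

variable {n : ℕ} {f g : ℤ × Fin (n - 1) → ℤ × Fin (n - 1)} {S : Finset ℤ}

theorem closed (hf : IsPartialMapping f S) {x : ℤ × Fin (n - 1)} (hx : x.1 ∈ S) :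
    (f x).1 ∈ S := by
  by_contra h
  have h1 := hf.supp _ h
  rw [hf.invol] at h1
  exact h (h1 ▸ hx)

/-- If `g` led from a free port of `f` to a linked one, it would agree with `f` there; being an
involution, it would show the first port to be the `f`-partner of the second. -/
theorem fixed_of_extends (hf : IsPartialMapping f S) (hg : IsPartialMapping g S)
    (hfg : ExtendsLinks f g) {x : ℤ × Fin (n - 1)} (hx : f x = x) : f (g x) = g x := by
  by_contra h
  have h1 := hfg _ h
  rw [hg.invol] at h1
  have h2 := hf.invol (g x)
  rw [← h1, hx] at h2
  rw [← h2] at h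
  exact h hx

/-- A node is linked to at most the other nodes of the ID set. -/
theorem card_nodePorts_lt (hf : IsPartialMapping f S) {u : ℤ} (hu : u ∈ S) :
    (nodePorts f u).card < S.card := by
  have h : (nodePorts f u).card ≤ (S.erase u).card := by
    refine Finset.card_le_card_of_injOn (fun i => (f (u, i)).1) ?_ ?_
    · intro i hi
      simp only [nodePorts, Finset.coe_filter, Finset.mem_univ, true_and, Set.mem_ofPred_eq] at hi
      simp only [Finset.coe_erase, Set.mem_sdiff, Finset.mem_coe, Set.mem_singleton_iff]
      exact ⟨hf.closed hu, hf.ne_self _ hi⟩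
    · intro i hi j hj hij
      simp only [nodePorts, Finset.coe_filter, Finset.mem_univ, true_and, Set.mem_ofPred_eq] at hi hj
      exact hf.simple u i j hi hj hij
  rw [Finset.card_erase_of_mem hu] at h
  have := Finset.card_pos.2 ⟨u, hu⟩
  omega

/-- The degree bound leaves a node v not linked to u. If all n - 1 ports of v were connected, they
would reach n - 1 distinct nodes of S \ {u, v}, which has at most n - 2. -/
theorem exists_partner (hf : IsPartialMapping f S) (hS : S.card ≤ n) {u : ℤ} (hu : u ∈ S)
    (hdeg : (nodePorts f u).card + 1 < S.card) :
    ∃ y : ℤ × Fin (n - 1), y.1 ∈ S ∧ y.1 ≠ u ∧ f y = y ∧ ∀ i, (f (u, i)).1 ≠ y.1 := by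
  classical
  obtain ⟨v, hvS, hv⟩ : ∃ v ∈ S, v ∉ insert u ((nodePorts f u).image fun i => (f (u, i)).1) := by
    by_contra! h
    have h1 := Finset.card_le_card (show S ⊆ _ from h)
    have h2 := Finset.card_insert_le u ((nodePorts f u).image fun i => (f (u, i)).1)
    have h3 : ((nodePorts f u).image fun i => (f (u, i)).1).card ≤ _ := Finset.card_image_le
    omega
  simp only [Finset.mem_insert, Finset.mem_image, not_or, not_exists, not_and] at hv
  obtain ⟨hvu, hv⟩ := hv
  have hlink : ∀ i, (f (u, i)).1 ≠ v := by
    intro i hi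
    by_cases h : f (u, i) = (u, i)
    · rw [h] at hi
      exact hvu hi.symm
    · exact hv i (by simp [nodePorts, h]) hi
  have hfree : ∃ j, f (v, j) = (v, j) := by
    by_contra! h
    have hc : (Finset.univ : Finset (Fin (n - 1))).card ≤ ((S.erase u).erase v).card := by
      refine Finset.card_le_card_of_injOn (fun i => (f (v, i)).1) ?_ ?_
      · intro i _
        simp only [Finset.coe_erase, Set.mem_sdiff, Finset.mem_coe, Set.mem_singleton_iff]
        refine ⟨⟨hf.closed hvS, fun h1 => ?_⟩, hf.ne_self _ (h i)⟩
        apply hlink (f (v, i)).2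
        rw [← h1, Prod.mk.eta, hf.invol]
      · intro i _ j _ hij
        exact hf.simple v i j (h i) (h j) hij
    rw [Finset.card_erase_of_mem (Finset.mem_erase.2 ⟨hvu, hvS⟩), Finset.card_erase_of_mem hu,
      Finset.card_fin] at hc
    omega
  obtain ⟨j, hj⟩ := hfree
  exact ⟨(v, j), hvS, hvu, hj, hlink⟩

theorem extends_addLink {x y : ℤ × Fin (n - 1)} (hx : f x = x) (hy : f y = y) :
    ExtendsLinks f (addLink f x y) := by
  intro z hz
  have h1 : z ≠ x := by rintro rfl; exact hz hx
  have h2 : z ≠ y := by rintro rfl; exact hz hy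
  simp [addLink, h1, h2]

theorem addLink (hf : IsPartialMapping f S) {x y : ℤ × Fin (n - 1)} (hxS : x.1 ∈ S)
    (hyS : y.1 ∈ S) (hx : f x = x) (hy : f y = y) (hxy : y.1 ≠ x.1)
    (hlink : ∀ i, (f (x.1, i)).1 ≠ y.1) : IsPartialMapping (addLink f x y) S := by
  have hne : y ≠ x := fun h => hxy (by rw [h])
  have hlink' : ∀ i, (f (y.1, i)).1 ≠ x.1 := by
    intro i hi
    apply hlink (f (y.1, i)).2
    rw [← hi, Prod.mk.eta, hf.invol]
  have key : ∀ z, z ≠ x → z ≠ y → f z ≠ x ∧ f z ≠ y := by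
    intro z h1 h2
    constructor
    · intro h
      rw [← h, hf.invol] at hx
      exact h1 (hx.trans h)
    · intro h
      rw [← h, hf.invol] at hy
      exact h2 (hy.trans h)
  have ex : _root_.addLink f x y x = y := by simp [_root_.addLink]
  have ey : _root_.addLink f x y y = x := by simp [_root_.addLink, hne]
  have ez : ∀ z, z ≠ x → z ≠ y → _root_.addLink f x y z = f z := by
    intro z h1 h2
    simp [_root_.addLink, h1, h2]
  refine ⟨?_, ?_, ?_, ?_⟩
  · intro z
    by_cases h1 : z = x
    · rw [h1, ex, ey]
    by_cases h2 : z = y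
    · rw [h2, ey, ex]
    rw [ez z h1 h2, ez _ (key z h1 h2).1 (key z h1 h2).2, hf.invol]
  · intro z
    by_cases h1 : z = x
    · rw [h1, ex]
      exact fun _ => hxy
    by_cases h2 : z = y
    · rw [h2, ey]
      exact fun _ => hxy.symm
    rw [ez z h1 h2]
    exact hf.ne_self z
  · intro u i j
    by_cases hi1 : (u, i) = x
    · by_cases hj1 : (u, j) = x
      · intros
        have := hi1.trans hj1.symm
        simpa using this
      have hj2 : (u, j) ≠ y := by
        intro h
        exact hxy (by rw [← h, ← hi1])
      rw [ez _ hj1 hj2, hi1, ex]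
      intro _ _ h
      subst hi1
      exact absurd h.symm (hlink j)
    by_cases hi2 : (u, i) = y
    · by_cases hj2 : (u, j) = y
      · intros
        have := hi2.trans hj2.symm
        simpa using this
      have hj1 : (u, j) ≠ x := by
        intro h
        exact hxy (by rw [← h, ← hi2])
      rw [ez _ hj1 hj2, hi2, ey]
      intro _ _ h
      subst hi2
      exact absurd h.symm (hlink' j)
    rw [ez _ hi1 hi2]
    by_cases hj1 : (u, j) = x
    · rw [hj1, ex]
      intro _ _ h
      subst hj1
      exact absurd h (hlink i)
    by_cases hj2 : (u, j) = y
    · rw [hj2, ey]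
      intro _ _ h
      subst hj2
      exact absurd h (hlink' i)
    rw [ez _ hj1 hj2]
    exact hf.simple u i j
  · intro z hz
    have h1 : z ≠ x := by rintro rfl; exact hz hxS
    have h2 : z ≠ y := by rintro rfl; exact hz hyS
    rw [ez z h1 h2]
    exact hf.supp z hz

theorem card_freePorts_addLink_lt {x y : ℤ × Fin (n - 1)} (hxS : x.1 ∈ S)
    (hx : f x = x) (hy : f y = y) (hxy : y.1 ≠ x.1) :
    (freePorts (_root_.addLink f x y) S).card < (freePorts f S).card := by
  have hne : y ≠ x := fun h => hxy (by rw [h])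
  apply Finset.card_lt_card
  refine (Finset.ssubset_iff_of_subset ?_).2 ⟨x, mem_freePorts.2 ⟨hxS, hx⟩, ?_⟩
  · intro z hz
    rw [mem_freePorts] at hz ⊢
    refine ⟨hz.1, ?_⟩
    by_contra h
    have := extends_addLink hx hy z h
    rw [hz.2] at this
    exact h this.symm
  · rw [mem_freePorts]
    simp [_root_.addLink, hne]

/-- On `n` nodes, a partial port mapping can be completed. -/
theorem exists_complete (hn : S.card = n) (hf : IsPartialMapping f S) :
    ∃ g, IsPartialMapping g S ∧ ExtendsLinks f g ∧ ∀ x : ℤ × Fin (n - 1), x.1 ∈ S → g x ≠ x := by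
  induction h : (freePorts f S).card using Nat.strong_induction_on generalizing f with
  | _ m ih =>
    by_cases hall : ∀ x : ℤ × Fin (n - 1), x.1 ∈ S → f x ≠ x
    · exact ⟨f, hf, ExtendsLinks.refl f, hall⟩
    push Not at hall
    obtain ⟨x, hxS, hx⟩ := hall
    -- The free port leaves `x.1` with at most n - 2 links.
    have hdeg : (nodePorts f x.1).card + 1 < S.card := by
      have h1 : nodePorts f x.1 ⊂ Finset.univ := by
        refine (Finset.ssubset_iff_of_subset (Finset.subset_univ _)).2 ⟨x.2, Finset.mem_univ _, ?_⟩
        simp [nodePorts, hx]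
      have h2 := Finset.card_lt_card h1
      rw [Finset.card_fin] at h2
      omega
    obtain ⟨y, hyS, hyx, hy, hlink⟩ := hf.exists_partner hn.le hxS hdeg
    obtain ⟨g, hg, hext, hfull⟩ := ih _ (h ▸ card_freePorts_addLink_lt hxS hx hy hyx)
      (hf.addLink hxS hyS hx hy hyx hlink) rfl
    exact ⟨g, hg, (extends_addLink hx hy).trans hext, hfull⟩

/-- A node that is linked to all other nodes of a set twice as large has many new links. -/
theorem card_linkedPorts_ge (hf : IsPartialMapping f S) (hg : IsPartialMapping g S)
    (hfg : ExtendsLinks f g) {u : ℤ} (hu : u ∈ S) {s : ℕ}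
    (hs : (nodePorts f u).card + s ≤ (nodePorts g u).card) :
    (linkedPorts f S).card + 2 * s ≤ (linkedPorts g S).card := by
  classical
  -- The ports of `u` that are new in `g`. Their far ends `N.image g` lie at other nodes and are new
  -- as well, whence the factor 2.
  set N := (nodePorts g u \ nodePorts f u).image fun i => (u, i) with hN
  have hNmem : ∀ x, x ∈ N ↔ x.1 = u ∧ f x = x ∧ g x ≠ x := by
    rintro ⟨a, i⟩
    simp only [hN, nodePorts, Finset.mem_image, Finset.mem_sdiff, Finset.mem_filter,
      Finset.mem_univ, true_and, not_not, Prod.mk.injEq]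
    constructor
    · rintro ⟨j, ⟨h1, h2⟩, rfl, rfl⟩
      exact ⟨rfl, h2, h1⟩
    · rintro ⟨h0, h2, h1⟩
      subst h0
      exact ⟨i, ⟨h1, h2⟩, rfl, rfl⟩
  have hNc : s ≤ N.card := by
    rw [hN, Finset.card_image_of_injective _ (Prod.mk_right_injective u)]
    have := Finset.le_card_sdiff (nodePorts f u) (nodePorts g u)
    omega
  have hgN : (N.image g).card = N.card :=
    Finset.card_image_of_injective _ (Function.LeftInverse.injective hg.invol)
  have hd1 : Disjoint N (N.image g) := by
    rw [Finset.disjoint_left]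
    intro x hx hx'
    obtain ⟨y, hy, rfl⟩ := Finset.mem_image.1 hx'
    rw [hNmem] at hx hy
    exact hg.ne_self y hy.2.2 (hx.1.trans hy.1.symm)
  have hd2 : Disjoint (linkedPorts f S) (N ∪ N.image g) := by
    rw [Finset.disjoint_left]
    intro x hx hx'
    rw [mem_linkedPorts] at hx
    rcases Finset.mem_union.1 hx' with h | h
    · exact hx.2 ((hNmem x).1 h).2.1
    · obtain ⟨y, hy, rfl⟩ := Finset.mem_image.1 h
      exact hx.2 (hf.fixed_of_extends hg hfg ((hNmem y).1 hy).2.1)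
  have hsub : linkedPorts f S ∪ (N ∪ N.image g) ⊆ linkedPorts g S := by
    intro x hx
    rw [mem_linkedPorts]
    rcases Finset.mem_union.1 hx with h | h
    · rw [mem_linkedPorts] at h
      refine ⟨h.1, ?_⟩
      rw [hfg x h.2]
      exact h.2
    rcases Finset.mem_union.1 h with h | h
    · rw [hNmem] at h
      exact ⟨h.1 ▸ hu, h.2.2⟩
    · obtain ⟨y, hy, rfl⟩ := Finset.mem_image.1 h
      rw [hNmem] at hy
      refine ⟨hg.closed (hy.1 ▸ hu), ?_⟩
      rw [hg.invol]
      exact hy.2.2.symm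
  have := Finset.card_le_card hsub
  rw [Finset.card_union_of_disjoint hd2, Finset.card_union_of_disjoint hd1, hgN] at this
  omega

end IsPartialMapping

/-! ### Gluing mappings on disjoint ID sets -/

open Classical in
/-- The union of partial port mappings on disjoint ID sets. -/
noncomputable def glue {n : ℕ} {ι : Type*} (J : Finset ι) (S : ι → Finset ℤ)
    (f : ι → ℤ × Fin (n - 1) → ℤ × Fin (n - 1)) : ℤ × Fin (n - 1) → ℤ × Fin (n - 1) :=
  fun x => if h : ∃ j ∈ J, x.1 ∈ S j then f h.choose x else x

section glue

variable {n : ℕ} {ι : Type*} {J : Finset ι} {S : ι → Finset ℤ}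
  {f : ι → ℤ × Fin (n - 1) → ℤ × Fin (n - 1)}

theorem glue_apply (hS : Pairwise (Function.onFun Disjoint S)) {j : ι} (hj : j ∈ J)
    {x : ℤ × Fin (n - 1)} (hx : x.1 ∈ S j) : glue J S f x = f j x := by
  have h : ∃ j ∈ J, x.1 ∈ S j := ⟨j, hj, hx⟩
  have : h.choose = j := by
    by_contra hne
    exact Finset.disjoint_left.1 (hS hne) h.choose_spec.2 hx
  rw [glue, dif_pos h, this]

theorem isPartialMapping_glue (hS : Pairwise (Function.onFun Disjoint S))
    (hf : ∀ j ∈ J, IsPartialMapping (f j) (S j)) :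
    IsPartialMapping (glue J S f) (J.biUnion S) := by
  have key : ∀ x : ℤ × Fin (n - 1), (∃ j ∈ J, x.1 ∈ S j) ∨ glue J S f x = x := by
    intro x
    by_cases h : ∃ j ∈ J, x.1 ∈ S j
    · exact Or.inl h
    · exact Or.inr (by rw [glue, dif_neg h])
  refine ⟨?_, ?_, ?_, ?_⟩
  · intro x
    rcases key x with ⟨j, hj, hx⟩ | h
    · rw [glue_apply hS hj hx, glue_apply hS hj ((hf j hj).closed hx), (hf j hj).invol]
    · rw [h, h]
  · intro x
    rcases key x with ⟨j, hj, hx⟩ | h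
    · rw [glue_apply hS hj hx]
      exact (hf j hj).ne_self x
    · exact fun h' => absurd h h'
  · intro u a b
    rcases key (u, a) with ⟨j, hj, hx⟩ | h
    · rw [glue_apply hS hj hx, glue_apply hS hj (x := (u, b)) hx]
      exact (hf j hj).simple u a b
    · exact fun h' => absurd h h'
  · intro x hx
    rcases key x with ⟨j, hj, hx'⟩ | h
    · exact absurd (Finset.mem_biUnion.2 ⟨j, hj, hx'⟩) hx
    · exact h

end glue

/-! ### Executions under partial port mappings -/

namespace CliqueAlgorithm

variable {n : ℕ}

/-- The state of the node with ID `a` after `r` rounds under the partial port mapping `f`. -/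
def run (A : CliqueAlgorithm.{u, v} n) (f : ℤ × Fin (n - 1) → ℤ × Fin (n - 1)) :
    ℕ → ℤ → A.State
  | 0 => fun a => A.init a
  | r + 1 => fun a =>
      if (A.output (run A f r a)).isSome then run A f r a
      else A.step (run A f r a) fun j => A.sent (run A f r (f (a, j)).1) (f (a, j)).2

/-- Whether a message is sent over the port `x` in the round after the first `r` rounds. -/
def Sends (A : CliqueAlgorithm.{u, v} n) (f : ℤ × Fin (n - 1) → ℤ × Fin (n - 1)) (r : ℕ)
    (x : ℤ × Fin (n - 1)) : Prop :=
  (A.sent (A.run f r x.1) x.2).isSome = true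

/-- No node of `S` sends over a free port during the first `t` rounds. -/
def ValidFor (A : CliqueAlgorithm.{u, v} n) (f : ℤ × Fin (n - 1) → ℤ × Fin (n - 1))
    (S : Finset ℤ) (t : ℕ) : Prop :=
  ∀ r < t, ∀ x : ℤ × Fin (n - 1), x.1 ∈ S → A.Sends f r x → f x ≠ x

/-- Every link of `f` has carried a message during the first `t + 1` rounds. -/
def LinksUsed (A : CliqueAlgorithm.{u, v} n) (f : ℤ × Fin (n - 1) → ℤ × Fin (n - 1))
    (t : ℕ) : Prop :=
  ∀ x, f x ≠ x → ∃ r ≤ t, A.Sends f r x ∨ A.Sends f r (f x)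

variable {A : CliqueAlgorithm.{u, v} n} {f g : ℤ × Fin (n - 1) → ℤ × Fin (n - 1)} {S : Finset ℤ}
  {t : ℕ}

theorem ValidFor.mono (h : A.ValidFor f S t) {t' : ℕ} (ht : t' ≤ t) : A.ValidFor f S t' :=
  fun r hr => h r (hr.trans_le ht)

/-- Free ports carry nothing for t rounds, so it is irrelevant how `g` connects them among
themselves. This covers both extending (free ports get paired) and gluing (they stay free). The
states agree up to r = t inclusive, hence so do the messages of round t + 1. -/
theorem ValidFor.run_eq (hv : A.ValidFor f S t) (hc : ∀ x, x.1 ∈ S → (f x).1 ∈ S)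
    (hfg : ∀ x, x.1 ∈ S → f x ≠ x → g x = f x)
    (hg : ∀ x, x.1 ∈ S → f x = x → (g x).1 ∈ S ∧ f (g x) = g x) :
    ∀ r ≤ t, ∀ a ∈ S, A.run g r a = A.run f r a := by
  intro r
  induction r with
  | zero => intro _ a _; rfl
  | succ r ih =>
    intro hr a ha
    have ih' := ih (by omega)
    have hnone : ∀ x, x.1 ∈ S → f x = x → A.sent (A.run f r x.1) x.2 = none := by
      intro x hx hfx
      by_contra h
      exact hv r (by omega) x hx (Option.isSome_iff_ne_none.2 h) hfx
    have hmsg : (fun j => A.sent (A.run g r (g (a, j)).1) (g (a, j)).2) =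
        fun j => A.sent (A.run f r (f (a, j)).1) (f (a, j)).2 := by
      funext j
      by_cases h : f (a, j) = (a, j)
      -- Both sides are `none`: `f` returns to a free port its own outgoing message, and `g`
      -- delivers from a free port of `f` in `S`.
      · obtain ⟨h1, h2⟩ := hg (a, j) ha h
        rw [ih' _ h1, hnone _ h1 h2, h, hnone _ ha h]
      · rw [hfg (a, j) ha h, ih' _ (hc _ ha)]
    simp only [run]
    rw [ih' a ha, hmsg]

theorem ValidFor.run_eq_of_extends (hv : A.ValidFor f S t) (hf : IsPartialMapping f S)
    (hg : IsPartialMapping g S) (hfg : ExtendsLinks f g) :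
    ∀ r ≤ t, ∀ a ∈ S, A.run g r a = A.run f r a :=
  hv.run_eq (fun _ h => hf.closed h) (fun x _ => hfg x)
    fun _ hx h => ⟨hg.closed hx, hf.fixed_of_extends hg hfg h⟩

theorem ValidFor.of_extends (hv : A.ValidFor f S t) (hf : IsPartialMapping f S)
    (hg : IsPartialMapping g S) (hfg : ExtendsLinks f g) : A.ValidFor g S t := by
  intro r hr x hx hs
  rw [Sends, hv.run_eq_of_extends hf hg hfg r hr.le _ hx] at hs
  have := hv r hr x hx hs
  rw [hfg x this]
  exact this

theorem mem_of_linked (hf : IsPartialMapping f S) {x : ℤ × Fin (n - 1)} (hx : f x ≠ x) :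
    x.1 ∈ S := by
  by_contra h
  exact hx (hf.supp x h)

/-- Links can be added inside `S` until the algorithm terminates or some node is linked to all
other nodes of `S`. -/
theorem exists_saturated (T : ℕ) (hS : S.card ≤ n) (f : ℤ × Fin (n - 1) → ℤ × Fin (n - 1))
    (t : ℕ) (hf : IsPartialMapping f S) (ht : t < T) (hv : A.ValidFor f S t)
    (hu : A.LinksUsed f t) :
    (∃ g, IsPartialMapping g S ∧ A.ValidFor g S T) ∨
      ∃ t' < T, ∃ g, IsPartialMapping g S ∧ A.ValidFor g S t' ∧ A.LinksUsed g t' ∧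
        ExtendsLinks f g ∧ ∃ w ∈ S, S.card ≤ (nodePorts g w).card + 1 := by
  by_cases hall : ∀ x : ℤ × Fin (n - 1), x.1 ∈ S → A.Sends f t x → f x ≠ x
  · have hv' : A.ValidFor f S (t + 1) := by
      intro r hr
      rcases Nat.lt_succ_iff_lt_or_eq.1 hr with h | rfl
      · exact hv r h
      · exact hall
    by_cases hT : t + 1 = T
    · exact Or.inl ⟨f, hf, hT ▸ hv'⟩
    · refine exists_saturated T hS f (t + 1) hf (by omega) hv' ?_
      intro x hx
      obtain ⟨r, hr, h⟩ := hu x hx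
      exact ⟨r, by omega, h⟩
  · push Not at hall
    obtain ⟨x, hxS, hsx, hx⟩ := hall
    by_cases hdeg : S.card ≤ (nodePorts f x.1).card + 1
    · exact Or.inr ⟨t, ht, f, hf, hv, hu, ExtendsLinks.refl f, x.1, hxS, hdeg⟩
    -- The message leaving over `x` in round t + 1 is routed to a node inside `S`. The first t
    -- rounds are unaffected, and this very message makes the new link a used one.
    · obtain ⟨y, hyS, hyx, hy, hlink⟩ := hf.exists_partner hS hxS (not_le.1 hdeg)
      have hg := hf.addLink hxS hyS hx hy hyx hlink
      have hext := IsPartialMapping.extends_addLink hx hy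
      have hrun := hv.run_eq_of_extends hf hg hext
      have hlt := IsPartialMapping.card_freePorts_addLink_lt hxS hx hy hyx
      have hne : y ≠ x := fun h => hyx (by rw [h])
      have hsends : ∀ r ≤ t, ∀ z : ℤ × Fin (n - 1), z.1 ∈ S → A.Sends f r z →
          A.Sends (addLink f x y) r z := by
        intro r hr z hz h
        rwa [Sends, hrun r hr _ hz]
      have hu' : A.LinksUsed (addLink f x y) t := by
        intro z hz
        by_cases h1 : z = x
        · exact ⟨t, le_rfl, Or.inl (by rw [h1]; exact hsends t le_rfl x hxS hsx)⟩
        by_cases h2 : z = y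
        · refine ⟨t, le_rfl, Or.inr ?_⟩
          have : addLink f x y z = x := by simp [addLink, h2, hne]
          rw [this]
          exact hsends t le_rfl x hxS hsx
        have hzf : addLink f x y z = f z := by simp [addLink, h1, h2]
        rw [hzf] at hz ⊢
        have hzS := mem_of_linked hf hz
        obtain ⟨r, hr, h⟩ := hu z hz
        exact ⟨r, hr, h.imp (hsends r hr z hzS) (hsends r hr _ (hf.closed hzS))⟩
      rcases exists_saturated T hS (addLink f x y) t hg ht (hv.of_extends hf hg hext) hu' with
        h | ⟨t', ht', g, h1, h2, h3, h4, h5⟩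
      · exact Or.inl h
      · exact Or.inr ⟨t', ht', g, h1, h2, h3, hext.trans h4, h5⟩
-- Either the round advances, or it stays and a new link consumes free ports.
termination_by (T - t, (freePorts f S).card)

section glue

variable {ι : Type*} {J : Finset ι} {S : ι → Finset ℤ}
  {f : ι → ℤ × Fin (n - 1) → ℤ × Fin (n - 1)}

theorem run_glue (hS : Pairwise (Function.onFun Disjoint S))
    (hf : ∀ j ∈ J, IsPartialMapping (f j) (S j)) (hv : ∀ j ∈ J, A.ValidFor (f j) (S j) t)
    {j : ι} (hj : j ∈ J) : ∀ r ≤ t, ∀ a ∈ S j, A.run (glue J S f) r a = A.run (f j) r a := by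
  refine (hv j hj).run_eq (fun _ h => (hf j hj).closed h) (fun x hx _ => glue_apply hS hj hx) ?_
  intro x hx h
  rw [glue_apply hS hj hx, h]
  exact ⟨hx, h⟩

theorem validFor_glue (hS : Pairwise (Function.onFun Disjoint S))
    (hf : ∀ j ∈ J, IsPartialMapping (f j) (S j)) (hv : ∀ j ∈ J, A.ValidFor (f j) (S j) t) :
    A.ValidFor (glue J S f) (J.biUnion S) t := by
  intro r hr x hx hs
  obtain ⟨j, hj, hx⟩ := Finset.mem_biUnion.1 hx
  rw [Sends, run_glue hS hf hv hj r hr.le _ hx] at hs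
  rw [glue_apply hS hj hx]
  exact hv j hj r hr x hx hs

theorem linksUsed_glue (hS : Pairwise (Function.onFun Disjoint S))
    (hf : ∀ j ∈ J, IsPartialMapping (f j) (S j)) (hv : ∀ j ∈ J, A.ValidFor (f j) (S j) t)
    (hu : ∀ j ∈ J, A.LinksUsed (f j) t) : A.LinksUsed (glue J S f) t := by
  intro x hx
  obtain ⟨j, hj, hxj⟩ := Finset.mem_biUnion.1 (mem_of_linked (isPartialMapping_glue hS hf) hx)
  rw [glue_apply hS hj hxj] at hx ⊢
  obtain ⟨r, hr, h⟩ := hu j hj x hx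
  refine ⟨r, hr, ?_⟩
  rwa [Sends, Sends, run_glue hS hf hv hj r hr _ hxj,
    run_glue hS hf hv hj r hr _ ((hf j hj).closed hxj)]

end glue

/-- A valid partial execution on `n` IDs is the beginning of an execution on the clique. -/
theorem exists_execution (hn : S.card = n) (hf : IsPartialMapping f S) (hv : A.ValidFor f S t) :
    ∃ (ids : Fin n → ℤ) (p : PortMapping n), Function.Injective ids ∧
      Finset.univ.image ids = S ∧
      ∀ r ≤ t, ∀ w, A.stateAfter ids p r w = A.run f r (ids w) := by
  obtain ⟨g, hg, hfg, hfull⟩ := hf.exists_complete hn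
  let e : Fin n ≃ S := (S.equivFinOfCardEq hn).symm
  have hcl : ∀ w i, (g ((e w : ℤ), i)).1 ∈ S := fun w i => hg.closed (e w).2
  let F : Fin n × Fin (n - 1) → Fin n × Fin (n - 1) := fun x =>
    (e.symm ⟨(g ((e x.1 : ℤ), x.2)).1, hcl x.1 x.2⟩, (g ((e x.1 : ℤ), x.2)).2)
  have hF1 : ∀ x, ((e (F x).1 : ℤ)) = (g ((e x.1 : ℤ), x.2)).1 := by
    intro x
    simp [F]
  have hF2 : ∀ x, (F x).2 = (g ((e x.1 : ℤ), x.2)).2 := fun x => rfl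
  let p : PortMapping n :=
    { toFun := F
      symm' := by
        intro x
        apply Prod.ext
        · apply e.injective
          apply Subtype.ext
          rw [hF1, hF1, hF2, Prod.mk.eta, hg.invol]
        · rw [hF2, hF1, hF2, Prod.mk.eta, hg.invol]
      ne_self := by
        intro w i h
        have h1 := hF1 (w, i)
        rw [h] at h1
        exact hg.ne_self _ (hfull ((e w : ℤ), i) (e w).2) h1.symm
      simple := by
        intro w i j h
        have h1 := hF1 (w, i)
        dsimp only at h
        rw [h, hF1 (w, j)] at h1
        exact hg.simple _ _ _ (hfull _ (e w).2) (hfull _ (e w).2) h1.symm }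
  have hrun : ∀ r w, A.stateAfter (fun w => (e w : ℤ)) p r w = A.run g r (e w) := by
    intro r
    induction r with
    | zero => intro w; rfl
    | succ r ih =>
      intro w
      simp only [stateAfter, run, ih]
      have : ∀ j, ((e (p.toFun (w, j)).1 : ℤ)) = (g ((e w : ℤ), j)).1 := fun j => hF1 (w, j)
      simp only [this]
      rfl
  refine ⟨fun w => (e w : ℤ), p, Subtype.val_injective.comp e.injective, ?_, ?_⟩
  · ext a
    simp only [Finset.mem_image, Finset.mem_univ, true_and]
    constructor
    · rintro ⟨w, rfl⟩
      exact (e w).2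
    · intro ha
      exact ⟨e.symm ⟨a, ha⟩, by simp⟩
  · intro r hr w
    rw [hrun, hv.run_eq_of_extends hf hg hfg r hr _ (e w).2]

end CliqueAlgorithm

/-! ### Silent and busy clusters -/

namespace CliqueAlgorithm

variable {n : ℕ}

theorem card_le_messageCount (A : CliqueAlgorithm.{u, v} n) (ids : Fin n → ℤ) (p : PortMapping n)
    (R : ℕ) (X : Finset (ℤ × Fin (n - 1)))
    (hX : ∀ x ∈ X, ∃ r < R, ∃ w, ids w = x.1 ∧
      (A.sent (A.stateAfter ids p r w) x.2).isSome = true) :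
    X.card ≤ A.messageCount ids p R := by
  classical
  have hsub : X ⊆ (Finset.range R).biUnion fun r => (Finset.univ : Finset (Fin n)).biUnion fun w =>
      (Finset.univ.filter fun i : Fin (n - 1) =>
        (A.sent (A.stateAfter ids p r w) i).isSome = true).image fun i => (ids w, i) := by
    intro x hx
    obtain ⟨r, hr, w, hw, hs⟩ := hX x hx
    simp only [Finset.mem_biUnion, Finset.mem_range, Finset.mem_univ, true_and, Finset.mem_image,
      Finset.mem_filter]
    exact ⟨r, hr, w, x.2, hs, by rw [hw]⟩
  refine (Finset.card_le_card hsub).trans (Finset.card_biUnion_le.trans ?_)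
  refine Finset.sum_le_sum fun r _ => Finset.card_biUnion_le.trans ?_
  exact Finset.sum_le_sum fun w _ => Finset.card_image_le

/-- `S` carries a partial execution in which no message leaves `S` for `T` rounds. -/
def IsSilent (A : CliqueAlgorithm.{u, v} n) (T : ℕ) (S : Finset ℤ) : Prop :=
  ∃ f, IsPartialMapping f S ∧ A.ValidFor f S T

/-- `S` carries a partial execution in which no message leaves `S` for `t` rounds and which has
`m` connected ports, all of whose links are used by the end of round `t + 1`. -/
def IsBusy (A : CliqueAlgorithm.{u, v} n) (m : ℕ) (S : Finset ℤ) (t : ℕ) : Prop :=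
  ∃ f, IsPartialMapping f S ∧ A.ValidFor f S t ∧ A.LinksUsed f t ∧ m ≤ (linkedPorts f S).card

variable {A : CliqueAlgorithm.{u, v} n} {U : Set ℤ} {T : ℕ} {N : ℕ} {S : Fin N → Finset ℤ}

/-- Silent clusters with n IDs in all glue to a full execution on the clique, in which each runs as
it does alone. -/
theorem sum_leaders (hA : A.ElectsLeaderWithin U T) (hS : Pairwise (Function.onFun Disjoint S))
    (hU : ∀ j, (S j : Set ℤ) ⊆ U) {J : Finset (Fin N)} (hJ : (J.biUnion S).card = n)
    {f : Fin N → ℤ × Fin (n - 1) → ℤ × Fin (n - 1)}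
    (hf : ∀ j ∈ J, IsPartialMapping (f j) (S j)) (hv : ∀ j ∈ J, A.ValidFor (f j) (S j) T) :
    ∑ j ∈ J, ((S j).filter fun a => A.output (A.run (f j) T a) = some true).card = 1 := by
  classical
  obtain ⟨ids, p, hinj, himg, hrun⟩ :=
    exists_execution hJ (isPartialMapping_glue hS hf) (validFor_glue hS hf hv)
  have hidU : ∀ w, ids w ∈ U := by
    intro w
    have : ids w ∈ J.biUnion S := himg ▸ Finset.mem_image_of_mem ids (Finset.mem_univ w)
    obtain ⟨j, _, hj⟩ := Finset.mem_biUnion.1 this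
    exact hU j hj
  obtain ⟨w, hw, huniq⟩ := (hA ids hinj hidU p).2
  have h1 : ∑ j ∈ J, ((S j).filter fun a => A.output (A.run (f j) T a) = some true).card =
      ((J.biUnion S).filter fun a => A.output (A.run (glue J S f) T a) = some true).card := by
    rw [Finset.filter_biUnion, Finset.card_biUnion]
    · refine Finset.sum_congr rfl fun j hj => ?_
      congr 1
      refine Finset.filter_congr fun a ha => ?_
      rw [run_glue hS hf hv hj T le_rfl a ha]
    · intro a _ b _ hab
      exact Finset.disjoint_filter_filter (hS hab)
  rw [h1, Finset.card_eq_one]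
  refine ⟨ids w, ?_⟩
  ext a
  simp only [Finset.mem_filter, Finset.mem_singleton]
  rw [← himg]
  constructor
  · rintro ⟨ha, h⟩
    obtain ⟨w', _, rfl⟩ := Finset.mem_image.1 ha
    rw [← hrun T le_rfl] at h
    rw [huniq w' h]
  · rintro rfl
    refine ⟨Finset.mem_image_of_mem ids (Finset.mem_univ w), ?_⟩
    rw [← hrun T le_rfl]
    exact hw

/-- Silent sets cannot be so many that the clique can be covered by them in different ways. -/
theorem card_silent_le (hA : A.ElectsLeaderWithin U T)
    (hS : Pairwise (Function.onFun Disjoint S)) (hU : ∀ j, (S j : Set ℤ) ⊆ U) {s m : ℕ}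
    (hs : ∀ j, (S j).card = s) (hm : 2 ≤ m) (hn : m * s = n) {K : Finset (Fin N)}
    (hK : ∀ j ∈ K, A.IsSilent T (S j)) : K.card ≤ m := by
  classical
  by_contra hlt
  obtain ⟨K', hK', hcard⟩ := Finset.exists_subset_card_eq (show m + 1 ≤ K.card by omega)
  have hK'' : ∀ j, ∃ f, j ∈ K' → IsPartialMapping f (S j) ∧ A.ValidFor f (S j) T := by
    intro j
    by_cases hj : j ∈ K'
    · obtain ⟨f, hf⟩ := hK j (hK' hj)
      exact ⟨f, fun _ => hf⟩
    · exact ⟨fun x => x, fun h => absurd h hj⟩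
  choose f hf using hK''
  set l : Fin N → ℕ :=
    fun j => ((S j).filter fun a => A.output (A.run (f j) T a) = some true).card with hl
  have h1 : ∀ j ∈ K', ∑ i ∈ K'.erase j, l i = 1 := by
    intro j hj
    refine sum_leaders hA hS hU ?_ (fun i hi => (hf i (Finset.mem_of_mem_erase hi)).1)
      fun i hi => (hf i (Finset.mem_of_mem_erase hi)).2
    rw [Finset.card_biUnion fun a _ b _ hab => hS hab, Finset.sum_congr rfl fun i _ => hs i,
      Finset.sum_const, Finset.card_erase_of_mem hj, hcard, smul_eq_mul]
    simpa using hn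
  -- The right side does not depend on `j`, so all `l j` are equal and m times their common value is
  -- 1.
  have h2 : ∀ j ∈ K', l j = ∑ i ∈ K', l i - 1 := by
    intro j hj
    have := Finset.add_sum_erase K' l hj
    rw [h1 j hj] at this
    omega
  obtain ⟨j, hj⟩ : K'.Nonempty := Finset.card_pos.1 (by omega)
  have h3 := h1 j hj
  rw [Finset.sum_congr rfl fun i hi => h2 i (Finset.mem_of_mem_erase hi), Finset.sum_const,
    Finset.card_erase_of_mem hj, hcard, smul_eq_mul] at h3
  have := Nat.eq_one_of_mul_eq_one_right h3
  omega

/-- The union of two sets that are busy at the same time is silent or busier. -/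
theorem silent_or_busy_of_busy {s m t : ℕ} (hS : Pairwise (Function.onFun Disjoint S))
    {a b : Fin N} (hab : a ≠ b) (hs : ∀ j, (S j).card = s) (hn : 2 * s ≤ n) (ht : t < T)
    (ha : A.IsBusy m (S a) t) (hb : A.IsBusy m (S b) t) :
    A.IsSilent T (({a, b} : Finset (Fin N)).biUnion S) ∨
      ∃ t' < T, A.IsBusy (2 * m + 2 * s) (({a, b} : Finset (Fin N)).biUnion S) t' := by
  classical
  have hex : ∀ j, ∃ f, j ∈ ({a, b} : Finset (Fin N)) → IsPartialMapping f (S j) ∧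
      A.ValidFor f (S j) t ∧ A.LinksUsed f t ∧ m ≤ (linkedPorts f (S j)).card := by
    intro j
    by_cases hj : j ∈ ({a, b} : Finset (Fin N))
    · have hj' : j = a ∨ j = b := by simpa using hj
      rcases hj' with rfl | rfl
      · exact ha.imp fun _ h _ => h
      · exact hb.imp fun _ h _ => h
    · exact ⟨fun x => x, fun h => absurd h hj⟩
  choose f hf using hex
  have hp := isPartialMapping_glue hS fun j hj => (hf j hj).1
  have hv := validFor_glue hS (fun j hj => (hf j hj).1) fun j hj => (hf j hj).2.1
  have hu := linksUsed_glue hS (fun j hj => (hf j hj).1) (fun j hj => (hf j hj).2.1)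
    fun j hj => (hf j hj).2.2.1
  have hcard : (({a, b} : Finset (Fin N)).biUnion S).card = 2 * s := by
    rw [Finset.card_biUnion fun a _ b _ hab => hS hab, Finset.sum_pair hab, hs, hs]
    omega
  have hlinks : 2 * m ≤ (linkedPorts (glue {a, b} S f) (({a, b} : Finset _).biUnion S)).card := by
    have hd : Disjoint (linkedPorts (f a) (S a)) (linkedPorts (f b) (S b)) := by
      rw [Finset.disjoint_left]
      intro x hx hx'
      exact Finset.disjoint_left.1 (hS hab) (mem_linkedPorts.1 hx).1 (mem_linkedPorts.1 hx').1
    have hsub : linkedPorts (f a) (S a) ∪ linkedPorts (f b) (S b) ⊆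
        linkedPorts (glue {a, b} S f) (({a, b} : Finset _).biUnion S) := by
      have : ∀ j ∈ ({a, b} : Finset (Fin N)), linkedPorts (f j) (S j) ⊆
          linkedPorts (glue {a, b} S f) (({a, b} : Finset _).biUnion S) := by
        intro j hj x hx
        rw [mem_linkedPorts] at hx ⊢
        refine ⟨Finset.mem_biUnion.2 ⟨j, hj, hx.1⟩, ?_⟩
        rw [glue_apply hS hj hx.1]
        exact hx.2
      exact Finset.union_subset (this a (by simp)) (this b (by simp))
    have h1 := Finset.card_le_card hsub
    rw [Finset.card_union_of_disjoint hd] at h1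
    have h2 := (hf a (by simp)).2.2.2
    have h3 := (hf b (by simp)).2.2.2
    omega
  rcases exists_saturated T (hcard.trans_le hn) _ t hp ht hv hu with
    ⟨g, h⟩ | ⟨t', ht', g, hg, hgv, hgu, hext, w, hw, hdeg⟩
  · exact Or.inl ⟨g, h⟩
  · refine Or.inr ⟨t', ht', g, hg, hgv, hgu, ?_⟩
    obtain ⟨j, hj, hwj⟩ := Finset.mem_biUnion.1 hw
    -- Before new links are added, `w` is linked only inside its own half, so reaching degree 2s - 1
    -- takes at least s new links.
    have h1 : (nodePorts (glue {a, b} S f) w).card < s := by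
      have h2 := (hf j hj).1.card_nodePorts_lt hwj
      rw [hs] at h2
      have h3 : nodePorts (glue {a, b} S f) w = nodePorts (f j) w := by
        unfold nodePorts
        refine Finset.filter_congr fun i _ => ?_
        rw [glue_apply hS hj (x := (w, i)) hwj]
      rwa [h3]
    have := hp.card_linkedPorts_ge hg hext hw (s := s) (by omega)
    omega

/-! ### Doubling the clusters -/

/-- There are `N` disjoint sets of `2 ^ i` IDs from `U` that are silent or busy. -/
def HasClusters (A : CliqueAlgorithm.{u, v} n) (U : Set ℤ) (T i N : ℕ) : Prop :=
  ∃ S : Fin N → Finset ℤ, Pairwise (Function.onFun Disjoint S) ∧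
    ∀ j, (S j : Set ℤ) ⊆ U ∧ (S j).card = 2 ^ i ∧
      (A.IsSilent T (S j) ∨ ∃ t < T, A.IsBusy (i * 2 ^ i) (S j) t)

theorem hasClusters_zero (hn : 1 ≤ n) (hT : 1 ≤ T) (hU : (N : ℕ∞) ≤ U.encard) :
    A.HasClusters U T 0 N := by
  obtain ⟨V, hVU, hV⟩ := Set.exists_subset_encard_eq hU
  have hfin : V.Finite := Set.finite_of_encard_eq_coe hV
  have hcard : hfin.toFinset.card = N := by
    rw [hfin.encard_eq_coe_toFinset_card] at hV
    exact_mod_cast hV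
  let e := (hfin.toFinset.equivFinOfCardEq hcard).symm
  refine ⟨fun j => {(e j : ℤ)}, ?_, ?_⟩
  · intro a b hab
    rw [Function.onFun, Finset.disjoint_singleton]
    exact fun h => hab (e.injective (Subtype.ext h))
  · intro j
    refine ⟨?_, by simp, ?_⟩
    · have := (e j).2
      rw [Set.Finite.mem_toFinset] at this
      simpa using hVU this
    · rcases exists_saturated (A := A) (S := {(e j : ℤ)}) T (by simpa using hn) (fun x => x) 0
        (isPartialMapping_id _) hT (fun r hr => absurd hr (Nat.not_lt_zero r))
        (fun x hx => absurd rfl hx) with ⟨g, h⟩ | ⟨t', ht', g, hg, hgv, hgu, -, -⟩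
      · exact Or.inl ⟨g, h⟩
      · exact Or.inr ⟨t', ht', g, hg, hgv, hgu, by simp⟩

/-- Discarding the at most m ≤ n silent sets leaves T * (2 * M) busy ones; by pigeonhole 2 * M of
them share the same time t, and these are merged in pairs. -/
theorem HasClusters.succ (hA : A.ElectsLeaderWithin U T) (hT : 1 ≤ T) {i m M : ℕ} (hm : 2 ≤ m)
    (hn : m * 2 ^ i = n) (h : A.HasClusters U T i N) (hN : n + T * (2 * M) ≤ N) :
    A.HasClusters U T (i + 1) M := by
  classical
  obtain ⟨S, hS, hprop⟩ := h
  set K := Finset.univ.filter fun j => A.IsSilent T (S j) with hK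
  have hKc : K.card ≤ m :=
    card_silent_le hA hS (fun j => (hprop j).1) (fun j => (hprop j).2.1) hm hn
      fun j hj => (Finset.mem_filter.1 hj).2
  have hmn : m ≤ n := by
    rw [← hn]
    exact Nat.le_mul_of_pos_right m (by positivity)
  have hbusy : ∀ j, ∃ t, j ∈ Kᶜ → t < T ∧ A.IsBusy (i * 2 ^ i) (S j) t := by
    intro j
    by_cases hj : A.IsSilent T (S j)
    · exact ⟨0, fun h => absurd (by simpa [hK] using hj) (Finset.mem_compl.1 h)⟩
    · obtain ⟨t, ht⟩ := (hprop j).2.2.resolve_left hj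
      exact ⟨t, fun _ => ht⟩
  choose τ hτ using hbusy
  have hcompl : T * (2 * M) ≤ Kᶜ.card := by
    rw [Finset.card_compl, Fintype.card_fin]
    omega
  obtain ⟨t, ht, hfib⟩ := Finset.exists_le_card_fiber_of_mul_le_card_of_maps_to
    (t := Finset.range T) (fun j hj => Finset.mem_range.2 (hτ j hj).1)
    ⟨0, Finset.mem_range.2 hT⟩ (by rwa [Finset.card_range])
  rw [Finset.mem_range] at ht
  set F := Kᶜ.filter fun j => τ j = t with hF
  have hFb : ∀ j ∈ F, A.IsBusy (i * 2 ^ i) (S j) t := by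
    intro j hj
    rw [hF, Finset.mem_filter] at hj
    exact hj.2 ▸ (hτ j hj.1).2
  obtain ⟨e⟩ : Nonempty (Fin M × Bool ↪ F) := by
    apply Function.Embedding.nonempty_of_card_le
    simp only [Fintype.card_prod, Fintype.card_fin, Fintype.card_bool, Fintype.card_coe]
    omega
  have hne : ∀ x y : Fin M × Bool, x ≠ y → (e x : Fin N) ≠ e y :=
    fun x y hxy h => hxy (e.injective (Subtype.ext h))
  refine ⟨fun j => ({(e (j, false) : Fin N), (e (j, true) : Fin N)} : Finset (Fin N)).biUnion S,
    ?_, ?_⟩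
  · intro a b hab
    simp only [Function.onFun, Finset.biUnion_insert, Finset.singleton_biUnion,
      Finset.disjoint_union_left, Finset.disjoint_union_right]
    refine ⟨⟨?_, ?_⟩, ?_, ?_⟩ <;> exact hS (hne _ _ (by simp [hab]))
  · intro j
    have hj : (e (j, false) : Fin N) ≠ e (j, true) := hne _ _ (by simp)
    refine ⟨?_, ?_, ?_⟩
    · intro a ha
      obtain ⟨l, -, hl⟩ := Finset.mem_biUnion.1 (Finset.mem_coe.1 ha)
      exact (hprop l).1 hl
    · rw [Finset.card_biUnion fun a _ b _ hab => hS hab, Finset.sum_pair hj, (hprop _).2.1,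
        (hprop _).2.1, pow_succ]
      omega
    · have h2s : 2 * 2 ^ i ≤ n := hn ▸ Nat.mul_le_mul_right _ hm
      have := silent_or_busy_of_busy hS hj (fun j => (hprop j).2.1) h2s ht
        (hFb _ (e (j, false)).2) (hFb _ (e (j, true)).2)
      rwa [show 2 * (i * 2 ^ i) + 2 * 2 ^ i = (i + 1) * 2 ^ (i + 1) by ring] at this

/-- Here `d` is the number of doublings left until half of the clique, and each doubling uses up a
factor n * T of the supply of clusters. -/
theorem hasClusters_of_le (hA : A.ElectsLeaderWithin U T) (hT : 1 ≤ T) (hn3 : 3 ≤ n) (d : ℕ) :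
    ∀ i, n = 2 ^ (i + d + 1) → A.HasClusters U T 0 (n ^ (i + d + 1) * T ^ (i + d)) →
      A.HasClusters U T i (n ^ (d + 1) * T ^ d) := by
  intro i
  induction i generalizing d with
  | zero => intro _ h; simpa using h
  | succ i ih =>
    intro hn h
    have e : i + 1 + d = i + (d + 1) := by omega
    rw [e] at hn h
    have h1 := ih (d + 1) hn h
    refine h1.succ hA hT (m := 2 ^ (d + 2)) ?_ ?_ ?_
    · calc 2 = 2 ^ 1 := rfl
        _ ≤ 2 ^ (d + 2) := Nat.pow_le_pow_right (by norm_num) (by omega)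
    · rw [hn, ← pow_add]
      congr 1
      omega
    · set X := n ^ (d + 1) * T ^ d with hX
      -- The discarded silent sets cost no more than one further copy of T * X; the three copies
      -- then fit into n * (T * X).
      have hXn : n ≤ T * X := by
        calc n = 1 * (n ^ 1 * 1) := by ring
          _ ≤ T * (n ^ (d + 1) * T ^ d) := by
            gcongr
            · omega
            · omega
            · exact Nat.one_le_pow _ _ hT
      calc n + T * (2 * X) ≤ 3 * (T * X) := by linarith
        _ ≤ n * (T * X) := Nat.mul_le_mul_right _ hn3
        _ = n ^ (d + 1 + 1) * T ^ (d + 1) := by rw [hX]; ring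

/-! ### From busy clusters to messages -/

/-- A busy set and a disjoint set that together have `n` IDs give an execution with many
messages. -/
theorem exists_messageCount_ge {m t s : ℕ} (hS : Pairwise (Function.onFun Disjoint S))
    (hU : ∀ j, (S j : Set ℤ) ⊆ U) {a b : Fin N} (hab : a ≠ b) (hs : ∀ j, (S j).card = s)
    (hn : 2 * s = n) (ht : t < T) (ha : A.IsBusy m (S a) t) (hb : A.IsSilent t (S b)) :
    ∃ ids : Fin n → ℤ, Function.Injective ids ∧ (∀ w, ids w ∈ U) ∧
      ∃ p : PortMapping n, m ≤ 2 * A.messageCount ids p T := by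
  classical
  obtain ⟨fa, hfa, hva, hua, hma⟩ := ha
  obtain ⟨fb, hfb, hvb⟩ := hb
  set J : Finset (Fin N) := {a, b} with hJ
  set f : Fin N → ℤ × Fin (n - 1) → ℤ × Fin (n - 1) := fun j => if j = a then fa else fb with hfdef
  have hJab : ∀ j ∈ J, j = a ∨ j = b := by
    intro j hj
    simpa [hJ] using hj
  have hf : ∀ j ∈ J, IsPartialMapping (f j) (S j) := by
    intro j hj
    rcases hJab j hj with rfl | rfl
    · simpa [hfdef] using hfa
    · simpa [hfdef, hab.symm] using hfb
  have hv : ∀ j ∈ J, A.ValidFor (f j) (S j) t := by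
    intro j hj
    rcases hJab j hj with rfl | rfl
    · simpa [hfdef] using hva
    · simpa [hfdef, hab.symm] using hvb
  have haJ : a ∈ J := by simp [hJ]
  have hcard : (J.biUnion S).card = n := by
    rw [Finset.card_biUnion fun a _ b _ hab => hS hab, hJ, Finset.sum_pair hab, hs, hs]
    omega
  obtain ⟨ids, p, hinj, himg, hrun⟩ :=
    exists_execution hcard (isPartialMapping_glue hS hf) (validFor_glue hS hf hv)
  refine ⟨ids, hinj, ?_, p, ?_⟩
  · intro w
    have : ids w ∈ J.biUnion S := himg ▸ Finset.mem_image_of_mem ids (Finset.mem_univ w)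
    obtain ⟨j, _, hj⟩ := Finset.mem_biUnion.1 this
    exact hU j hj
  -- The connected ports that have sent. Each link has at least one of its two ports in `X`, whence
  -- the factor 2 in the conclusion.
  set X := (linkedPorts fa (S a)).filter fun x => ∃ r ≤ t, A.Sends fa r x with hX
  have hXc : X.card ≤ A.messageCount ids p T := by
    refine card_le_messageCount A ids p T X ?_
    intro x hx
    obtain ⟨hx1, r, hr, hsx⟩ := Finset.mem_filter.1 hx
    have hxa := (mem_linkedPorts.1 hx1).1
    obtain ⟨w, -, hw⟩ := Finset.mem_image.1 (himg ▸ Finset.mem_biUnion.2 ⟨a, haJ, hxa⟩)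
    -- Even r = t is allowed: round t + 1 is within T, and its messages depend only on the states
    -- after t rounds.
    refine ⟨r, by omega, w, hw, ?_⟩
    rw [hrun r hr, hw, run_glue hS hf hv haJ r hr _ hxa]
    simpa [hfdef, Sends] using hsx
  have hsub : linkedPorts fa (S a) ⊆ X ∪ X.image fa := by
    intro x hx
    obtain ⟨hxa, hne⟩ := mem_linkedPorts.1 hx
    obtain ⟨r, hr, h | h⟩ := hua x hne
    · exact Finset.mem_union_left _ (Finset.mem_filter.2 ⟨hx, r, hr, h⟩)
    · refine Finset.mem_union_right _ (Finset.mem_image.2 ⟨fa x, ?_, hfa.invol x⟩)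
      refine Finset.mem_filter.2 ⟨mem_linkedPorts.2 ⟨hfa.closed hxa, ?_⟩, r, hr, h⟩
      rw [hfa.invol]
      exact hne.symm
  have h1 := (Finset.card_le_card hsub).trans (Finset.card_union_le _ _)
  have h2 : (X.image fa).card ≤ X.card := Finset.card_image_le
  omega

/-- At most two sets of half the clique's size are silent, so one of three is busy, and any second
set completes it to n IDs. If both are busy, the one with the smaller time supplies the messages,
since the other is still isolated then. -/
theorem HasClusters.exists_messageCount_ge (hA : A.ElectsLeaderWithin U T) {i : ℕ}
    (hn : 2 * 2 ^ i = n) (hN : 3 ≤ N) (h : A.HasClusters U T i N) :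
    ∃ ids : Fin n → ℤ, Function.Injective ids ∧ (∀ w, ids w ∈ U) ∧
      ∃ p : PortMapping n, i * 2 ^ i ≤ 2 * A.messageCount ids p T := by
  obtain ⟨S, hS, hprop⟩ := h
  have hU := fun j => (hprop j).1
  have hs := fun j => (hprop j).2.1
  obtain ⟨a, ha⟩ : ∃ a, ¬ A.IsSilent T (S a) := by
    by_contra! hall
    have := card_silent_le hA hS hU hs le_rfl hn (K := Finset.univ) fun j _ => hall j
    rw [Finset.card_univ, Fintype.card_fin] at this
    omega
  obtain ⟨t, ht, hbusy⟩ := (hprop a).2.2.resolve_left ha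
  obtain ⟨b, hb⟩ : ∃ b, a ≠ b := by
    have : Nontrivial (Fin N) := Fin.nontrivial_iff_two_le.2 (by omega)
    exact (exists_ne a).imp fun _ h => h.symm
  have silent : ∀ {j t t'}, t ≤ t' → A.IsBusy (i * 2 ^ i) (S j) t' → A.IsSilent t (S j) :=
    fun htt ⟨f, hf, hv, _⟩ => ⟨f, hf, hv.mono htt⟩
  rcases (hprop b).2.2 with ⟨f, hf, hv⟩ | ⟨t', ht', hbusy'⟩
  · exact CliqueAlgorithm.exists_messageCount_ge hS hU hb hs hn ht hbusy ⟨f, hf, hv.mono ht.le⟩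
  · rcases le_total t t' with htt | htt
    · exact CliqueAlgorithm.exists_messageCount_ge hS hU hb hs hn ht hbusy (silent htt hbusy')
    · exact CliqueAlgorithm.exists_messageCount_ge hS hU hb.symm hs hn ht' hbusy'
        (silent htt hbusy)

end CliqueAlgorithm

/-! ### The lower bound -/

theorem mainTheorem2 :
    ∃ c : ℝ, 0 < c ∧ ∃ n₀ : ℕ, ∀ n k : ℕ, n₀ ≤ n → n = 2 ^ k →
      ∀ T : ℕ, 1 ≤ T → ∀ U : Set ℤ, ((n ^ k * T ^ (k - 1) : ℕ) : ℕ∞) ≤ U.encard →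
        ∀ A : CliqueAlgorithm.{u, v} n, A.ElectsLeaderWithin U T →
          ∃ ids : Fin n → ℤ, Function.Injective ids ∧ (∀ w, ids w ∈ U) ∧
            ∃ p : PortMapping n,
              c * (n * Real.logb 2 n) ≤ (A.messageCount ids p T : ℝ) := by
  -- With n = 2^(i + 1) there are at least i * 2^i / 2 messages, and i / 2 ≥ (i + 1) / 4 once i ≥ 1,
  -- which n ≥ 4 ensures; it also leaves at least three final clusters.
  refine ⟨1 / 8, by norm_num, 4, ?_⟩
  intro n k hn4 hnk T hT U hU A hA
  obtain ⟨i, rfl⟩ : ∃ i, k = i + 1 := by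
    refine Nat.exists_eq_add_one.2 (Nat.pos_of_ne_zero ?_)
    rintro rfl
    omega
  have hi : 1 ≤ i := by
    by_contra h
    obtain rfl : i = 0 := by omega
    omega
  have h0 : A.HasClusters U T 0 (n ^ (i + 1) * T ^ i) :=
    CliqueAlgorithm.hasClusters_zero (by omega) hT (by simpa using hU)
  have h1 := CliqueAlgorithm.hasClusters_of_le hA hT (by omega) 0 i hnk h0
  obtain ⟨ids, hinj, hids, p, hp⟩ := h1.exists_messageCount_ge hA (by rw [hnk]; ring)
    (by simp; omega)
  refine ⟨ids, hinj, hids, p, ?_⟩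
  have hlog : Real.logb 2 (n : ℝ) = i + 1 := by
    rw [hnk]
    push_cast
    rw [Real.logb_pow, Real.logb_self_eq_one (by norm_num)]
    push_cast
    ring
  have hnR : (n : ℝ) = 2 * 2 ^ i := by
    rw [hnk]
    push_cast
    ring
  have hpR : (i : ℝ) * 2 ^ i ≤ 2 * (A.messageCount ids p T : ℝ) := by exact_mod_cast hp
  have hiR : (1 : ℝ) ≤ i := by exact_mod_cast hi
  rw [hlog, hnR]
  have h2 : (0 : ℝ) < 2 ^ i := by positivity
  nlinarith [mul_le_mul_of_nonneg_right hiR h2.le]
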